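/- Let $A$ be a unital $C^*$-algebra with centre $Z(A)$, let $I$ be a closed two-sided ideal of $A$, and let $a\in A$ be such that $a+I\in Z(A/I)$. For a unital $C^*$-algebra $B$ let $\mathrm{Prim}(B)$ be the set of primitive ideals of $B$ (the kernels of irreducible $*$-representations of $B$ on Hilbert spaces) and, for $z\in Z(B)$, let $\Psi_B(z):\mathrm{Prim}(B)\to\mathbb{C}$ be the Dauns–Hofmann function of $z$, that is, $\Psi_B(z)(P)$ is the unique scalar with $z+P=\Psi_B(z)(P)\,1+P$ in $B/P$ for each $P\in\mathrm{Prim}(B)$. Then $a\in Z(A)+I$ if and only if $$\Psi_{A/I}(a+I)(P_1/I)=\Psi_{A/I}(a+I)(P_2/I)$$ for all $P_1,P_2\in\mathrm{Prim}(A)$ with $I\subseteq P_1$, $I\subseteq P_2$ and $P_1\cap Z(A)=P_2\cap Z(A)$. -/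

import Mathlib

universe u

open scoped Pointwise

section Primitive

variable {B : Type u} [Ring B] [StarRing B] [Algebra ℂ B]

/-- A unital `*`-representation `π` of `B` on a Hilbert space `H` is (topologically) irreducible
if `H ≠ 0` and the only closed subspaces of `H` invariant under `π(B)` are `0` and `H`. -/
def IsIrreducibleRep {H : Type u} [NormedAddCommGroup H] [InnerProductSpace ℂ H] [CompleteSpace H]
    (π : B →⋆ₐ[ℂ] (H →L[ℂ] H)) : Prop :=
  Nontrivial H ∧ ∀ K : Submodule ℂ H, IsClosed (K : Set H) →
    (∀ b : B, ∀ ξ ∈ K, π b ξ ∈ K) → K = ⊥ ∨ K = ⊤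

/-- A primitive ideal is the kernel of an irreducible `*`-representation on a Hilbert space.
(An irreducible representation has a cyclic vector, so for a C⋆-algebra `B`, Hilbert spaces in the
universe of `B` are enough, up to unitary equivalence.) -/
def IsPrimitiveIdeal (P : Ideal B) : Prop :=
  ∃ (H : Type u) (_ : NormedAddCommGroup H) (_ : InnerProductSpace ℂ H) (_ : CompleteSpace H)
    (π : B →⋆ₐ[ℂ] (H →L[ℂ] H)), IsIrreducibleRep π ∧ P = RingHom.ker π

variable (B) in
/-- `Prim B`, the set of primitive ideals of `B`. -/
def PrimitiveIdeals : Type u := {P : Ideal B // IsPrimitiveIdeal P}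

/-- Schur's lemma: an irreducible representation maps central elements to scalars. -/
theorem IsIrreducibleRep.exists_scalar {H : Type u} [NormedAddCommGroup H]
    [InnerProductSpace ℂ H] [CompleteSpace H] {π : B →⋆ₐ[ℂ] (H →L[ℂ] H)}
    (hπ : IsIrreducibleRep π) {z : B} (hz : z ∈ Set.center B) :
    ∃ c : ℂ, π z = c • (1 : H →L[ℂ] H) := by
  obtain ⟨hH, hK⟩ := hπ
  have hcomm : ∀ b : B, Commute (π z) (π b) := fun b => by
    have h : z * b = b * z := (Set.mem_center_iff.1 hz).comm b
    show π z * π b = π b * π z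
    rw [← map_mul, h, map_mul]
  have hcomm' : ∀ b : B, Commute (star (π z)) (π b) := fun b => by
    have h := (hcomm (star b)).star_star
    rwa [map_star, star_star] at h
  have hn : IsStarNormal (π z) := ⟨by
    have h := hcomm (star z)
    rw [map_star] at h
    exact h.symm⟩
  have key : ∀ f g : ℂ → ℂ, Continuous f → Continuous g → (∀ t, f t * g t = 0) →
      cfc f (π z) = 0 ∨ cfc g (π z) = 0 := by
    intro f g hf hg hfg
    have hmul : cfc f (π z) * cfc g (π z) = 0 := by
      rw [← cfc_mul f g (π z) hf.continuousOn hg.continuousOn]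
      simp [hfg]
    have hinv : ∀ b : B, ∀ ξ ∈ LinearMap.ker (cfc f (π z)).toLinearMap,
        π b ξ ∈ LinearMap.ker (cfc f (π z)).toLinearMap := by
      intro b ξ hξ
      have h := congrArg (fun T : H →L[ℂ] H => T ξ) ((hcomm b).cfc (hcomm' b) f).eq
      have hξ' : cfc f (π z) ξ = 0 := by simpa using hξ
      simpa [hξ'] using h
    rcases hK _ (cfc f (π z)).isClosed_ker hinv with h | h
    · right
      ext ξ
      have : cfc g (π z) ξ ∈ LinearMap.ker (cfc f (π z)).toLinearMap := by
        have := congrArg (fun T : H →L[ℂ] H => T ξ) hmul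
        simpa using this
      rw [h] at this
      simpa using this
    · left
      ext ξ
      have : ξ ∈ LinearMap.ker (cfc f (π z)).toLinearMap := by rw [h]; trivial
      simpa using this
  obtain ⟨μ, hμ⟩ := spectrum.nonempty (π z)
  have hnz : ∀ (f : ℂ → ℂ) (ν : ℂ), Continuous f → ν ∈ spectrum ℂ (π z) → f ν ≠ 0 →
      cfc f (π z) ≠ 0 := by
    intro f ν hf hν hfν h
    have : f ν ∈ spectrum ℂ (cfc f (π z)) := by
      rw [cfc_map_spectrum f (π z) hn hf.continuousOn]
      exact ⟨ν, hν, rfl⟩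
    rw [h, spectrum.zero_eq] at this
    exact hfν this
  have hsub : ∀ ν ∈ spectrum ℂ (π z), ν = μ := by
    intro ν hν
    by_contra hne
    have hd : 0 < dist ν μ := dist_pos.2 hne
    let F : ℂ → ℂ → ℂ := fun c t => ((max 0 (dist ν μ / 2 - dist t c) : ℝ) : ℂ)
    have hF : ∀ c, Continuous (F c) := fun c => by fun_prop
    have hFc : ∀ c, F c c ≠ 0 := fun c => by
      simp only [F, dist_self, sub_zero]
      rw [max_eq_right (by positivity)]
      exact_mod_cast (by positivity : dist ν μ / 2 ≠ 0)
    have hFF : ∀ t, F ν t * F μ t = 0 := by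
      intro t
      simp only [F]
      rcases le_total (dist ν μ / 2) (dist t ν) with h | h
      · rw [max_eq_left (by linarith)]; simp
      · have h3 := dist_triangle_left ν μ t
        rw [max_eq_left (b := dist ν μ / 2 - dist t μ) (by linarith)]; simp
    rcases key (F ν) (F μ) (hF ν) (hF μ) hFF with h | h
    · exact hnz _ ν (hF ν) hν (hFc ν) h
    · exact hnz _ μ (hF μ) hμ (hFc μ) h
  refine ⟨μ, ?_⟩
  calc π z = cfc (fun t : ℂ => t) (π z) := (cfc_id' ℂ (π z) hn).symm
    _ = cfc (fun _ : ℂ => μ) (π z) := cfc_congr (fun t ht => hsub t ht)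
    _ = μ • (1 : H →L[ℂ] H) := by
      rw [cfc_const μ (π z) hn, Algebra.algebraMap_eq_smul_one]

/-- For `z` central and `P` primitive there is exactly one scalar `c` with `z + P = c 1 + P`. -/
theorem existsUnique_scalar (z : Subalgebra.center ℂ B) (P : PrimitiveIdeals B) :
    ∃! c : ℂ, (z : B) - c • (1 : B) ∈ P.1 := by
  obtain ⟨P, H, _, _, _, π, hπ, rfl⟩ := P
  obtain ⟨c, hc⟩ := hπ.exists_scalar z.2
  have := hπ.1
  refine ⟨c, ?_, fun d hd => ?_⟩
  · simp [RingHom.mem_ker, hc]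
  · simp only [RingHom.mem_ker, map_sub, map_smul, map_one, hc, ← sub_smul] at hd
    exact (sub_eq_zero.1 ((smul_eq_zero.1 hd).resolve_right one_ne_zero)).symm

/-- The Dauns-Hofmann function `Ψ_B(z) : Prim B → ℂ` of a central element `z` of `B`, determined
by `z + P = Ψ_B(z)(P) 1 + P` for all primitive ideals `P`. -/
noncomputable def daunsHofmann (z : Subalgebra.center ℂ B) (P : PrimitiveIdeals B) : ℂ :=
  (existsUnique_scalar z P).choose

theorem daunsHofmann_eq_iff (z : Subalgebra.center ℂ B) (P : PrimitiveIdeals B) (c : ℂ) :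
    daunsHofmann z P = c ↔ (z : B) - c • (1 : B) ∈ P.1 := by
  have h := (existsUnique_scalar z P).choose_spec
  exact ⟨fun e => e ▸ h.1, fun hc => (h.2 c hc).symm⟩

end Primitive

section Quotient

variable {A : Type u} [CStarAlgebra A] (I : Ideal A) [I.IsTwoSided] [hI : IsClosed (I : Set A)]

/-- Closed two-sided ideals of C⋆-algebras are self-adjoint. -/
theorem star_mem_of_isClosed {x : A} (hx : x ∈ I) : star x ∈ I := by
  have hmem : ∀ y : A, star x * x * y ∈ I := fun y =>
    I.mul_mem_right _ (I.mul_mem_left _ hx)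
  have hb : IsSelfAdjoint (star x * x) := .star_mul_self x
  refine hI.closure_subset (Metric.mem_closure_iff.2 fun ε hε => ?_)
  obtain ⟨m, hm⟩ := exists_nat_gt (1 / ε ^ 2)
  have hm0 : (0 : ℝ) < m := lt_trans (by positivity) hm
  let g : ℝ → ℝ := fun t => (1 + (m * t) ^ 2)⁻¹
  have hpos : ∀ t : ℝ, 0 < 1 + (m * t) ^ 2 := fun t => by positivity
  have hg : Continuous g := Continuous.inv₀ (by fun_prop) fun t => (hpos t).ne'
  set b := star x * x with hbdef
  set G := cfc g b with hG
  have hGs : star G = G := (cfc_predicate g b : IsSelfAdjoint _).star_eq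
  have h1 : 1 - G = b * ((m : ℝ) ^ 2 • (b * G)) := by
    have e1 : b * ((m : ℝ) ^ 2 • (b * G)) = cfc (fun t => t * ((m : ℝ) ^ 2 • (t * g t))) b := by
      rw [cfc_mul (fun t => t) (fun t => (m : ℝ) ^ 2 • (t * g t)) b (by fun_prop) (by fun_prop),
        cfc_smul ((m : ℝ) ^ 2) (fun t => t * g t) b (by fun_prop),
        cfc_mul (fun t => t) g b (by fun_prop) (by fun_prop), cfc_id' ℝ b]
    rw [e1, hG, ← cfc_one ℝ b, ← cfc_sub _ _ b (by fun_prop) (by fun_prop)]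
    refine cfc_congr fun t _ => ?_
    have := hpos t
    simp only [g, smul_eq_mul, Pi.one_apply]
    field_simp
    ring
  have h2 : (1 - G) * star x ∈ I := by
    rw [h1, mul_assoc]
    exact hmem _
  refine ⟨_, h2, ?_⟩
  have h3 : star x - (1 - G) * star x = star (x * G) := by
    rw [star_mul, hGs]; noncomm_ring
  rw [dist_eq_norm, h3, norm_star]
  have h4 : ‖x * G‖ ^ 2 ≤ 1 / m := by
    rw [sq, ← CStarRing.norm_star_mul_self]
    have e2 : star (x * G) * (x * G) = cfc (fun t => g t * (t * g t)) b := by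
      rw [cfc_mul g (fun t => t * g t) b (by fun_prop) (by fun_prop),
        cfc_mul (fun t => t) g b (by fun_prop) (by fun_prop), cfc_id' ℝ b, star_mul, hGs]
      simp only [hbdef, mul_assoc, hG]
    rw [e2]
    refine norm_cfc_le (by positivity) fun t _ => ?_
    have hp := hpos t
    have hg1 : g t ≤ 1 := inv_le_one_of_one_le₀ (by nlinarith [sq_nonneg (m * t)])
    have hg0 : 0 ≤ g t := inv_nonneg.2 hp.le
    have h5 : |t| * g t ≤ 1 / m := by
      simp only [g]
      rw [← div_eq_mul_inv, div_le_div_iff₀ hp hm0]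
      have : (m * t) ^ 2 = (m * |t|) ^ 2 := by rw [mul_pow, mul_pow, sq_abs]
      rw [this]
      nlinarith [sq_nonneg (m * |t| - 1), mul_nonneg hm0.le (abs_nonneg t)]
    rw [Real.norm_eq_abs, abs_mul, abs_mul, abs_of_nonneg hg0]
    exact (mul_le_of_le_one_left (by positivity) hg1).trans h5
  have h6 : (1 : ℝ) / m < ε ^ 2 := by
    rw [div_lt_iff₀ (by positivity)] at hm ⊢
    linarith
  exact lt_of_pow_lt_pow_left₀ 2 hε.le (h4.trans_lt h6)

/-- The involution of the quotient C⋆-algebra `A ⧸ I`: `(a + I)* = a* + I`. -/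
instance quotientStarRing : StarRing (A ⧸ I) where
  star := Quotient.map' star fun a b h => by
    rw [Submodule.quotientRel_def] at h ⊢
    rw [← star_sub]
    exact star_mem_of_isClosed I h
  star_involutive := by
    rintro ⟨a⟩
    exact congrArg (Ideal.Quotient.mk I) (star_star a)
  star_mul := by
    rintro ⟨a⟩ ⟨b⟩
    exact congrArg (Ideal.Quotient.mk I) (star_mul a b)
  star_add := by
    rintro ⟨a⟩ ⟨b⟩
    exact congrArg (Ideal.Quotient.mk I) (star_add a b)

theorem star_quotient_mk (a : A) :
    star (Ideal.Quotient.mk I a) = Ideal.Quotient.mk I (star a) := rfl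

/-- If `P ⊇ I` is primitive in `A`, then `P / I` is primitive in `A ⧸ I`. -/
theorem IsPrimitiveIdeal.map_mk {P : Ideal A} (hP : IsPrimitiveIdeal P) (hIP : I ≤ P) :
    IsPrimitiveIdeal (P.map (Ideal.Quotient.mk I)) := by
  obtain ⟨H, _, _, _, π, hπ, rfl⟩ := hP
  have h0 : ∀ a ∈ I, (π : A →ₐ[ℂ] (H →L[ℂ] H)) a = 0 := fun a ha => hIP ha
  let ρ : (A ⧸ I) →⋆ₐ[ℂ] (H →L[ℂ] H) :=
    { Ideal.Quotient.liftₐ I (π : A →ₐ[ℂ] (H →L[ℂ] H)) h0 with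
      map_star' := by
        rintro ⟨a⟩
        exact map_star π a }
  have hρ : ∀ a, ρ (Ideal.Quotient.mk I a) = π a := fun a => rfl
  refine ⟨H, _, _, _, ρ, ⟨hπ.1, fun K hK hinv => hπ.2 K hK fun a ξ hξ => ?_⟩, ?_⟩
  · exact hρ a ▸ hinv (Ideal.Quotient.mk I a) ξ hξ
  · ext y
    obtain ⟨a, rfl⟩ := Ideal.Quotient.mk_surjective y
    rw [RingHom.mem_ker, hρ, ← Ideal.mem_comap, Ideal.comap_map_mk hIP, RingHom.mem_ker]

/-- `Prim^I(A)`, the set of primitive ideals of `A` that contain `I`. -/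
def PrimitiveIdealsAbove : Type u := {P : PrimitiveIdeals A // I ≤ P.1}

variable {I} in
/-- The map `Prim^I(A) → Prim(A ⧸ I)`, `P ↦ P / I`. -/
def PrimitiveIdealsAbove.quot (P : PrimitiveIdealsAbove I) : PrimitiveIdeals (A ⧸ I) :=
  ⟨P.1.1.map (Ideal.Quotient.mk I), P.1.2.map_mk I P.2⟩

end Quotient

/-! If `a = z + i` with `z` central and `i ∈ I`, the scalar of `a + I` at `P / I` is the scalar `c`
with `z - c ∈ P`. As `z - c` is itself central, `c` depends only on `P ∩ Z(A)`.

For the converse, the image of `Z(A)` in `Z(A/I)` is a closed star subalgebra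
(`StarAlgHom.isClosed_range_cstar`, which needs quotients to be C⋆-algebras). By Gelfand duality and
Stone-Weierstrass (`StarSubalgebra.mem_of_forall_character`), `a + I` lies in it once any two
characters of `Z(A/I)` that agree on the image agree at `a + I`. Each character comes from a
primitive ideal containing `I` (`exists_primitiveIdealAbove_of_character`): extend it to an extreme
contractive functional and apply GNS. Agreement on the image forces `P₁ ∩ Z(A) = P₂ ∩ Z(A)`, so the
hypothesis applies. -/

/-! ### Quotients of C⋆-algebras -/

section QuotientCStar

variable {A : Type u} [CStarAlgebra A]

/-- Every element of a two-sided ideal is almost annihilated by the complement `1 - u` of a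
self-adjoint contraction, where `u` lies in the ideal. -/
theorem exists_norm_mul_one_sub_lt (I : Ideal A) [I.IsTwoSided] {x : A} (hx : x ∈ I) {ε : ℝ} (hε : 0 < ε) :
    ∃ u ∈ I, IsSelfAdjoint (1 - u) ∧ ‖1 - u‖ ≤ 1 ∧ ‖x * (1 - u)‖ < ε := by
  obtain ⟨m, hm⟩ := exists_nat_gt (1 / ε ^ 2)
  have hm0 : (0 : ℝ) < m := lt_trans (by positivity) hm
  -- With `b = star x * x`, the element `1 - u` will be `g(b)`. Since `1 - g(t)` is divisible by
  -- `t`, `u` lies in `I` without any closedness; since `|t| g(t)² ≤ 1/m < ε²`, the product `x * (1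
  -- - u)` is small.
  let g : ℝ → ℝ := fun t => (1 + (m * t) ^ 2)⁻¹
  have hpos : ∀ t : ℝ, 0 < 1 + (m * t) ^ 2 := fun t => by positivity
  have hg : Continuous g := Continuous.inv₀ (by fun_prop) fun t => (hpos t).ne'
  have hg1 : ∀ t, g t ≤ 1 := fun t => inv_le_one_of_one_le₀ (by nlinarith [sq_nonneg (m * t)])
  have hg0 : ∀ t, 0 ≤ g t := fun t => inv_nonneg.2 (hpos t).le
  have hb : IsSelfAdjoint (star x * x) := .star_mul_self x
  set b := star x * x with hbdef
  set G := cfc g b with hG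
  have hGs : IsSelfAdjoint G := cfc_predicate g b
  have h1 : 1 - G = b * ((m : ℝ) ^ 2 • (b * G)) := by
    have e1 : b * ((m : ℝ) ^ 2 • (b * G)) = cfc (fun t => t * ((m : ℝ) ^ 2 • (t * g t))) b := by
      rw [cfc_mul (fun t => t) (fun t => (m : ℝ) ^ 2 • (t * g t)) b (by fun_prop) (by fun_prop),
        cfc_smul ((m : ℝ) ^ 2) (fun t => t * g t) b (by fun_prop),
        cfc_mul (fun t => t) g b (by fun_prop) (by fun_prop), cfc_id' ℝ b]
    rw [e1, hG, ← cfc_one ℝ b, ← cfc_sub _ _ b (by fun_prop) (by fun_prop)]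
    refine cfc_congr fun t _ => ?_
    have := hpos t
    simp only [g, smul_eq_mul, Pi.one_apply]
    field_simp
    ring
  refine ⟨1 - G, ?_, by simpa using hGs, ?_, ?_⟩
  · rw [h1]
    exact I.mul_mem_right _ (I.mul_mem_left _ hx)
  · rw [sub_sub_cancel]
    refine norm_cfc_le zero_le_one fun t _ => ?_
    rw [Real.norm_eq_abs, abs_of_nonneg (hg0 t)]
    exact hg1 t
  rw [sub_sub_cancel]
  have h4 : ‖x * G‖ ^ 2 ≤ 1 / m := by
    rw [sq, ← CStarRing.norm_star_mul_self]
    have e2 : star (x * G) * (x * G) = cfc (fun t => g t * (t * g t)) b := by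
      rw [cfc_mul g (fun t => t * g t) b (by fun_prop) (by fun_prop),
        cfc_mul (fun t => t) g b (by fun_prop) (by fun_prop), cfc_id' ℝ b, star_mul, hGs.star_eq]
      simp only [hbdef, mul_assoc, hG]
    rw [e2]
    refine norm_cfc_le (by positivity) fun t _ => ?_
    have hp := hpos t
    have h5 : |t| * g t ≤ 1 / m := by
      simp only [g]
      rw [← div_eq_mul_inv, div_le_div_iff₀ hp hm0]
      have : (m * t) ^ 2 = (m * |t|) ^ 2 := by rw [mul_pow, mul_pow, sq_abs]
      rw [this]
      nlinarith [sq_nonneg (m * |t| - 1), mul_nonneg hm0.le (abs_nonneg t)]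
    rw [Real.norm_eq_abs, abs_mul, abs_mul, abs_of_nonneg (hg0 t)]
    exact (mul_le_of_le_one_left (mul_nonneg (abs_nonneg t) (hg0 t)) (hg1 t)).trans h5
  have h6 : (1 : ℝ) / m < ε ^ 2 := by
    rw [div_lt_iff₀ (by positivity)] at hm ⊢
    linarith
  exact lt_of_pow_lt_pow_left₀ 2 hε.le (h4.trans_lt h6)

theorem exists_quotient_mk_eq_norm_lt (I : Ideal A) (x : A ⧸ I) {ε : ℝ} (hε : 0 < ε) :
    ∃ y : A, (Submodule.Quotient.mk y : A ⧸ I) = x ∧ ‖y‖ < ‖x‖ + ε :=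
  Submodule.Quotient.norm_mk_lt x hε

variable (I : Ideal A) [I.IsTwoSided] [hI : IsClosed (I : Set A)]

/-- The quotient norm makes `A ⧸ I` a normed ring. -/
noncomputable instance quotientNormedRing : NormedRing (A ⧸ I) where
  __ := Ideal.Quotient.ring I
  __ := Submodule.Quotient.normedAddCommGroup I
  norm_mul_le x y := by
    have hlim : Filter.Tendsto (fun ε : ℝ => (‖x‖ + ε) * (‖y‖ + ε)) (nhdsWithin 0 (Set.Ioi 0))
        (nhds (‖x‖ * ‖y‖)) := by
      have : Continuous fun ε : ℝ => (‖x‖ + ε) * (‖y‖ + ε) := by fun_prop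
      simpa using (this.tendsto 0).mono_left nhdsWithin_le_nhds
    refine ge_of_tendsto hlim (Filter.eventually_of_mem self_mem_nhdsWithin fun ε hε => ?_)
    obtain ⟨a, rfl, ha⟩ := exists_quotient_mk_eq_norm_lt I x (Set.mem_Ioi.1 hε)
    obtain ⟨b, rfl, hb⟩ := exists_quotient_mk_eq_norm_lt I y (Set.mem_Ioi.1 hε)
    exact (Submodule.Quotient.norm_mk_le I (a * b)).trans ((norm_mul_le a b).trans
      (mul_le_mul ha.le hb.le (norm_nonneg _) ((norm_nonneg _).trans ha.le)))

noncomputable instance quotientNormedAlgebra : NormedAlgebra ℂ (A ⧸ I) where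
  __ := Ideal.Quotient.algebra ℂ
  norm_smul_le := norm_smul_le

theorem norm_quotient_mk_le (x : A) : ‖Ideal.Quotient.mk I x‖ ≤ ‖x‖ :=
  Submodule.Quotient.norm_mk_le I x

/-- The quotient of a C⋆-algebra by a closed two-sided ideal is a C⋆-algebra. -/
noncomputable instance quotientCStarAlgebra : CStarAlgebra (A ⧸ I) where
  __ := quotientNormedRing I
  __ := quotientStarRing I
  __ := quotientNormedAlgebra I
  __ := Submodule.Quotient.completeSpace I
  star_smul c y := by
    obtain ⟨x, rfl⟩ := Ideal.Quotient.mk_surjective y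
    exact congrArg (Ideal.Quotient.mk I) (star_smul c x)
  norm_mul_self_le x := by
    obtain ⟨x, rfl⟩ := Ideal.Quotient.mk_surjective x
    refine le_of_forall_pos_le_add fun ε hε => ?_
    obtain ⟨y, hy, hyn⟩ := exists_quotient_mk_eq_norm_lt I
      (star (Ideal.Quotient.mk I x) * Ideal.Quotient.mk I x) (half_pos hε)
    have hj : star x * x - y ∈ I := by
      rw [← Ideal.Quotient.eq]
      exact hy.symm
    -- Here `y` is an almost norm-minimal lift of the class of `star x * x`. Replacing `x` by `x *
    -- (1 - u)` keeps its class, while `1 - u` nearly kills the error `star x * x - y`.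
    obtain ⟨u, hu, hus, hu1, huj⟩ := exists_norm_mul_one_sub_lt I hj (half_pos hε)
    have hx : Ideal.Quotient.mk I x = Ideal.Quotient.mk I (x * (1 - u)) := by
      rw [Ideal.Quotient.eq, mul_sub, mul_one, sub_sub_cancel]
      exact I.mul_mem_left _ hu
    have h1 : ‖Ideal.Quotient.mk I x‖ ≤ ‖x * (1 - u)‖ := by
      rw [hx]
      exact norm_quotient_mk_le I _
    calc ‖Ideal.Quotient.mk I x‖ * ‖Ideal.Quotient.mk I x‖
        ≤ ‖x * (1 - u)‖ * ‖x * (1 - u)‖ := by gcongr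
      _ = ‖(1 - u) * (star x * x * (1 - u))‖ := by
        rw [← CStarRing.norm_star_mul_self, star_mul, hus.star_eq]
        simp only [mul_assoc]
      _ ≤ ‖star x * x * (1 - u)‖ :=
        (norm_mul_le _ _).trans (mul_le_of_le_one_left (norm_nonneg _) hu1)
      _ = ‖(star x * x - y) * (1 - u) + y * (1 - u)‖ := by rw [← add_mul, sub_add_cancel]
      _ ≤ ‖(star x * x - y) * (1 - u)‖ + ‖y‖ := (norm_add_le _ _).trans
        (add_le_add_right ((norm_mul_le _ _).trans
          (mul_le_of_le_one_right (norm_nonneg _) hu1)) _)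
      _ ≤ _ := by linarith

end QuotientCStar

/-! ### Closed ranges and Stone-Weierstrass -/

/-- The range of a `*`-homomorphism between C⋆-algebras is closed. -/
theorem StarAlgHom.isClosed_range_cstar {A : Type*} {B : Type*} [CStarAlgebra A] [CStarAlgebra B]
    (φ : A →⋆ₐ[ℂ] B) : IsClosed (Set.range φ) := by
  -- Dividing by the kernel makes the map injective, hence isometric, so its range is closed.
  let I : Ideal A := RingHom.ker φ
  have : I.IsTwoSided := inferInstanceAs (RingHom.ker φ).IsTwoSided
  have hφ : Continuous φ := by
    open scoped CStarAlgebra in exact map_continuous φ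
  have : IsClosed (I : Set A) := isClosed_singleton.preimage hφ
  have h0 : ∀ a ∈ I, (φ : A →ₐ[ℂ] B) a = 0 := fun a ha => ha
  let ψ : (A ⧸ I) →⋆ₐ[ℂ] B :=
    { Ideal.Quotient.liftₐ I (φ : A →ₐ[ℂ] B) h0 with
      map_star' := by
        rintro ⟨a⟩
        exact map_star φ a }
  have hψ : ∀ a, ψ (Ideal.Quotient.mk I a) = φ a := fun a => rfl
  have hinj : Function.Injective ψ := by
    rw [injective_iff_map_eq_zero]
    intro x hx
    obtain ⟨a, rfl⟩ := Ideal.Quotient.mk_surjective x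
    exact Ideal.Quotient.eq_zero_iff_mem.2 hx
  have hr : Set.range φ = Set.range ψ := by
    ext y
    constructor
    · rintro ⟨a, rfl⟩
      exact ⟨_, hψ a⟩
    · rintro ⟨x, rfl⟩
      obtain ⟨a, rfl⟩ := Ideal.Quotient.mk_surjective x
      exact ⟨a, (hψ a).symm⟩
  rw [hr]
  exact (NonUnitalStarAlgHom.isometry ψ hinj).isClosedEmbedding.isClosed_range

/-- A form of the Stone-Weierstrass theorem without separation of points: a function that is
constant on the sets on which all elements of a star subalgebra are constant lies in its closure. -/
theorem ContinuousMap.mem_closure_starSubalgebra {X : Type*} [TopologicalSpace X] [CompactSpace X]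
    (D : StarSubalgebra ℂ C(X, ℂ)) (f : C(X, ℂ))
    (hf : ∀ x y, (∀ g ∈ D, g x = g y) → f x = f y) : f ∈ closure (D : Set C(X, ℂ)) := by
  -- On the quotient of `X` by this relation the functions from `D` descend and separate points, and
  -- `f` descends by `hf`.
  let r : Setoid X :=
    { r := fun x y => ∀ g ∈ D, g x = g y
      iseqv := ⟨fun x g _ => rfl, fun h g hg => (h g hg).symm,
        fun h h' g hg => (h g hg).trans (h' g hg)⟩ }
  let q : C(X, Quotient r) := ⟨Quotient.mk r, continuous_quotient_mk'⟩
  let F : C(Quotient r, ℂ) →⋆ₐ[ℂ] C(X, ℂ) := ContinuousMap.compStarAlgHom' ℂ ℂ q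
  have hsep : (D.comap F).SeparatesPoints := by
    intro x y
    induction x using Quotient.inductionOn with | _ x
    induction y using Quotient.inductionOn with | _ y
    intro hxy
    have : ¬ ∀ g ∈ D, g x = g y := fun h => hxy (Quotient.sound h)
    push Not at this
    obtain ⟨g, hg, hne⟩ := this
    let g' : C(Quotient r, ℂ) := ⟨Quotient.lift g fun a b h => h g hg, g.continuous.quotient_lift _⟩
    refine ⟨g', ⟨g', ?_, rfl⟩, hne⟩
    show F g' ∈ D
    rwa [show F g' = g from rfl]
  have htop := ContinuousMap.starSubalgebra_topologicalClosure_eq_top_of_separatesPoints _ hsep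
  let f' : C(Quotient r, ℂ) := ⟨Quotient.lift f hf, f.continuous.quotient_lift _⟩
  have hf' : f' ∈ closure ((D.comap F : StarSubalgebra ℂ C(Quotient r, ℂ)) :
      Set C(Quotient r, ℂ)) := by
    rw [← StarSubalgebra.topologicalClosure_coe, htop]
    trivial
  have hF : Continuous F := ContinuousMap.continuous_precomp q
  exact map_mem_closure hF hf' fun g hg => hg

/-- An element of a commutative C⋆-algebra belongs to a closed star subalgebra as soon as every two
characters that agree on the subalgebra agree on the element. -/
theorem StarSubalgebra.mem_of_forall_character {Z : Type*} [CommCStarAlgebra Z]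
    (D : StarSubalgebra ℂ Z) (hD : IsClosed (D : Set Z)) (b : Z)
    (hb : ∀ χ₁ χ₂ : WeakDual.characterSpace ℂ Z, (∀ d ∈ D, χ₁ d = χ₂ d) → χ₁ b = χ₂ b) :
    b ∈ D := by
  let Γ := gelfandStarTransform Z
  have hΓ : Isometry Γ := gelfandTransform_isometry Z
  have h := ContinuousMap.mem_closure_starSubalgebra (D.map (Γ : Z →⋆ₐ[ℂ] _)) (Γ b)
    fun χ₁ χ₂ h => hb χ₁ χ₂ fun d hd => h (Γ d) ⟨d, hd, rfl⟩
  have himg : IsClosed (Γ '' (D : Set Z)) := hΓ.isClosedEmbedding.isClosedMap _ hD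
  have h' : Γ b ∈ Γ '' (D : Set Z) := by
    rw [← himg.closure_eq]
    exact h
  exact (Function.Injective.mem_set_image hΓ.injective).1 h'

open scoped ComplexOrder InnerProductSpace

/-! ### Extreme contractive extensions of a character -/

section States

variable {B : Type u} [CStarAlgebra B]

/-- A contractive functional with value `1` at the identity is positive. -/
theorem nonneg_of_contractive_of_map_one [PartialOrder B] [StarOrderedRing B] (f : B →ₗ[ℂ] ℂ)
    (hf : ∀ b, ‖f b‖ ≤ ‖b‖) (h1 : f 1 = 1) {x : B} (hx : 0 ≤ x) : 0 ≤ f x := by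
  have : Nontrivial B := ⟨1, 0, fun h => by simp [h] at h1⟩
  have hxs : IsSelfAdjoint x := hx.isSelfAdjoint
  -- The spectrum of `x` lies in `[0, 2r]`, so subtracting its midpoint `r` leaves norm at most `r`.
  set r : ℝ := ‖x‖ / 2 with hr
  have hr0 : 0 ≤ r := by positivity
  set y : B := x - algebraMap ℝ B r with hy
  have hys : IsSelfAdjoint y := hxs.sub (IsSelfAdjoint.algebraMap B (IsSelfAdjoint.all r))
  have hyn : ‖y‖ ≤ r := by
    have : y = cfc (fun t : ℝ => t - r) x := by
      rw [cfc_sub (fun t : ℝ => t) (fun _ => r) x, cfc_id' ℝ x, cfc_const r x]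
    rw [this]
    refine norm_cfc_le hr0 fun t ht => ?_
    have h0 : 0 ≤ t := spectrum_nonneg_of_nonneg hx ht
    have h2 : ‖t‖ ≤ ‖x‖ := spectrum.norm_le_norm_of_mem ht
    rw [Real.norm_eq_abs, abs_of_nonneg h0] at h2
    rw [Real.norm_eq_abs, abs_le]
    constructor <;> linarith
  have hfx : f x = f y + r := by
    have : x = y + (r : ℂ) • (1 : B) := by
      rw [hy, Algebra.algebraMap_eq_smul_one, Complex.coe_smul, sub_add_cancel]
    conv_lhs => rw [this]
    simp [h1]
  -- Contractivity at `y - it`, where `‖y - it‖² ≤ r² + t²`; the `t²` cancels, leaving a bound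
  -- linear in `t`.
  have key : ∀ t : ℝ, (f y).re ^ 2 + ((f y).im - t) ^ 2 ≤ r ^ 2 + t ^ 2 := by
    intro t
    have e1 : star (y - (t * Complex.I) • (1 : B)) * (y - (t * Complex.I) • (1 : B)) =
        y * y + ((t : ℂ) ^ 2) • (1 : B) := by
      simp only [star_sub, star_smul, hys.star_eq, star_one, sub_mul, mul_sub, smul_mul_assoc,
        mul_smul_comm, one_mul, mul_one]
      have : star ((t : ℂ) * Complex.I) = -(t * Complex.I) := by simp
      have h2 : (t : ℂ) ^ 2 = -(t * Complex.I * (t * Complex.I)) := by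
        linear_combination (t : ℂ) ^ 2 * Complex.I_sq
      rw [this, h2]
      module
    have e2 : ‖y - (t * Complex.I) • (1 : B)‖ ^ 2 ≤ r ^ 2 + t ^ 2 := by
      rw [sq, ← CStarRing.norm_star_mul_self, e1]
      refine (norm_add_le _ _).trans (add_le_add ?_ ?_)
      · rw [sq]
        exact (norm_mul_le _ _).trans (mul_le_mul hyn hyn (norm_nonneg _) hr0)
      · rw [norm_smul, norm_one, mul_one, norm_pow, Complex.norm_real, Real.norm_eq_abs, sq_abs]
    have e3 := hf (y - (t * Complex.I) • (1 : B))
    rw [map_sub, map_smul, h1] at e3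
    have e4 := (pow_le_pow_left₀ (norm_nonneg _) e3 2).trans e2
    rw [Complex.sq_norm, Complex.normSq_apply] at e4
    simp at e4
    nlinarith [e4]
  have him : (f y).im = 0 := by
    by_contra h
    -- This `t` makes the cross term `-2t Im f(y)` equal to `r² + 1`, exceeding the bound `r²`.
    have := key (-(r ^ 2 + 1) / (2 * (f y).im))
    have e : 2 * (f y).im * (-(r ^ 2 + 1) / (2 * (f y).im)) = -(r ^ 2 + 1) := by field_simp
    nlinarith [sq_nonneg (f y).re, sq_nonneg (f y).im]
  have hre : -r ≤ (f y).re := by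
    have := key 0
    rw [him] at this
    exact (abs_le_of_sq_le_sq' (by linarith) hr0).1
  rw [hfx, Complex.nonneg_iff]
  constructor
  · simp; linarith
  · simp [him]

/-- The contractive functionals on `B` that extend `χ`. -/
def contractiveExtensions (E : StarSubalgebra ℂ B) (χ : E →ₐ[ℂ] ℂ) : Set (WeakDual ℂ B) :=
  {f | (∀ b, ‖f b‖ ≤ ‖b‖) ∧ ∀ z : E, f z = χ z}

variable {E : StarSubalgebra ℂ B} {χ : E →ₐ[ℂ] ℂ}

/-- Banach-Alaoglu: the defining conditions are weak-* closed and force norm at most `1`. -/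
theorem isCompact_contractiveExtensions : IsCompact (contractiveExtensions E χ) := by
  refine (WeakDual.isCompact_closedBall (𝕜 := ℂ) (0 : StrongDual ℂ B) 1).of_isClosed_subset ?_ ?_
  · have : contractiveExtensions E χ =
        (⋂ b : B, {f | ‖f b‖ ≤ ‖b‖}) ∩ ⋂ z : E, {f : WeakDual ℂ B | f z = χ z} := by
      ext f
      simp [contractiveExtensions]
    rw [this]
    exact (isClosed_iInter fun b =>
        isClosed_le (WeakDual.eval_continuous b).norm continuous_const).inter
      (isClosed_iInter fun z => isClosed_eq (WeakDual.eval_continuous _) continuous_const)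
  · intro f hf
    simp only [Set.mem_preimage, Metric.mem_closedBall, dist_zero_right]
    exact ContinuousLinearMap.opNorm_le_bound _ zero_le_one fun b => by simpa using hf.1 b

/-- Norm-preserving Hahn-Banach extension. -/
theorem contractiveExtensions_nonempty (hχ : ∀ z, ‖χ z‖ ≤ ‖z‖) :
    (contractiveExtensions E χ).Nonempty := by
  let g : StrongDual ℂ (Subalgebra.toSubmodule E.toSubalgebra) :=
    LinearMap.mkContinuous (χ.toLinearMap : E →ₗ[ℂ] ℂ) 1 fun z => by
      rw [one_mul]
      exact hχ z
  obtain ⟨f, hf, hn⟩ := exists_extension_norm_eq _ g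
  have hg : ‖g‖ ≤ 1 := LinearMap.mkContinuous_norm_le _ zero_le_one _
  refine ⟨StrongDual.toWeakDual f, fun b => ?_, fun z => hf z⟩
  exact (f.le_opNorm b).trans (mul_le_of_le_one_left (norm_nonneg _) (hn ▸ hg))

/-- If the vector functional of a cyclic unit vector is extreme among the contractive extensions of
a character of a subalgebra acting by scalars, then the representation is irreducible. -/
theorem isIrreducibleRep_of_mem_extremePoints {H : Type u} [NormedAddCommGroup H]
    [InnerProductSpace ℂ H] [CompleteSpace H] (π : B →⋆ₐ[ℂ] (H →L[ℂ] H)) (ξ : H) (hξ : ‖ξ‖ = 1)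
    (hcyc : DenseRange fun b => π b ξ) (hz : ∀ z : E, π z = χ z • (1 : H →L[ℂ] H))
    (ω : WeakDual ℂ B) (hωξ : ∀ b, ω b = ⟪ξ, π b ξ⟫_ℂ)
    (hω : ω ∈ (contractiveExtensions E χ).extremePoints ℝ) : IsIrreducibleRep π := by
  have hst : ∀ b x y, ⟪π (star b) x, y⟫_ℂ = ⟪x, π b y⟫_ℂ := fun b x y => by
    rw [map_star]
    exact ContinuousLinearMap.adjoint_inner_left _ _ _
  have hξ0 : ξ ≠ 0 := fun h => by simp [h] at hξ
  refine ⟨⟨ξ, 0, hξ0⟩, fun K hK hinv => ?_⟩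
  have : CompleteSpace K := hK.completeSpace_coe
  have hinv' : ∀ b : B, ∀ x ∈ Kᗮ, π b x ∈ Kᗮ := fun b x hx => by
    rw [Submodule.mem_orthogonal] at hx ⊢
    intro u hu
    rw [← hst]
    exact hx _ (hinv _ u hu)
  have htop : ∀ L : Submodule ℂ H, IsClosed (L : Set H) → (∀ b : B, ∀ x ∈ L, π b x ∈ L) → ξ ∈ L →
      L = ⊤ := fun L hL hLinv h => by
    rw [eq_top_iff]
    intro x _
    exact hL.closure_subset_iff.2 (Set.range_subset_iff.2 fun b => hLinv b ξ h) (hcyc x)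
  obtain ⟨η, hη, ζ, hζ, hsum⟩ : ∃ η ∈ K, ∃ ζ ∈ Kᗮ, ξ = η + ζ :=
    ⟨K.starProjection ξ, Submodule.starProjection_apply_mem _ _, ξ - K.starProjection ξ,
      Submodule.sub_starProjection_mem_orthogonal _, (add_sub_cancel _ _).symm⟩
  by_cases hη0 : η = 0
  · left
    have h := htop Kᗮ K.isClosed_orthogonal hinv' (by rwa [hsum, hη0, zero_add])
    rw [← Submodule.orthogonal_orthogonal K, h, Submodule.top_orthogonal_eq_bot]
  by_cases hζ0 : ζ = 0
  · exact .inr (htop K hK hinv (by rwa [hsum, hζ0, add_zero]))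
  right
  -- Because `E` acts by the scalars `χ`, every normalized vector functional restricts to `χ`.
  have hφ : ∀ v : H, v ≠ 0 → ∃ φ ∈ contractiveExtensions E χ,
      ∀ b, φ b = ((‖v‖ ^ 2 : ℝ) : ℂ)⁻¹ * ⟪v, π b v⟫_ℂ := by
    intro v hv
    have hv' : 0 < ‖v‖ := norm_pos_iff.2 hv
    have hbd : ∀ b, ‖((‖v‖ ^ 2 : ℝ) : ℂ)⁻¹ * ⟪v, π b v⟫_ℂ‖ ≤ ‖b‖ := fun b => by
      rw [norm_mul, norm_inv, Complex.norm_real, Real.norm_of_nonneg (by positivity),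
        inv_mul_le_iff₀ (by positivity)]
      calc ‖⟪v, π b v⟫_ℂ‖ ≤ ‖v‖ * ‖π b v‖ := norm_inner_le_norm _ _
        _ ≤ ‖v‖ * (‖b‖ * ‖v‖) := by
          gcongr
          exact ((π b).le_opNorm v).trans (mul_le_mul_of_nonneg_right
            (NonUnitalStarAlgHom.norm_apply_le π b) (norm_nonneg v))
        _ = ‖v‖ ^ 2 * ‖b‖ := by ring
    let φ : B →ₗ[ℂ] ℂ :=
      { toFun := fun b => ((‖v‖ ^ 2 : ℝ) : ℂ)⁻¹ * ⟪v, π b v⟫_ℂ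
        map_add' := fun b c => by simp [mul_add]
        map_smul' := fun c b => by simp; ring }
    refine ⟨StrongDual.toWeakDual (φ.mkContinuous 1 fun b => (hbd b).trans (one_mul ‖b‖).ge),
      ⟨fun b => hbd b, fun z => ?_⟩, fun b => rfl⟩
    show ((‖v‖ ^ 2 : ℝ) : ℂ)⁻¹ * ⟪v, π z v⟫_ℂ = χ z
    rw [hz z]
    have : ((‖v‖ : ℂ) ^ 2) ≠ 0 := by exact_mod_cast (pow_pos hv' 2).ne'
    simp only [smul_apply, one_apply_eq_self, inner_smul_right,
      inner_self_eq_norm_sq_to_K]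
    push_cast
    field_simp
    simp [mul_comm]
  obtain ⟨φ₁, hφ₁, e₁⟩ := hφ η hη0
  obtain ⟨φ₂, hφ₂, e₂⟩ := hφ ζ hζ0
  have hηζ : ⟪η, ζ⟫_ℂ = 0 := hζ _ hη
  have hcross : ∀ b, ⟪η, π b ζ⟫_ℂ = 0 := fun b => hinv' b ζ hζ _ hη
  have hcross' : ∀ b, ⟪ζ, π b η⟫_ℂ = 0 := fun b => by
    rw [← hst]
    exact (Submodule.mem_orthogonal' _ _).1 (hinv' (star b) ζ hζ) _ hη
  have hpos₁ : 0 < ‖η‖ ^ 2 := pow_pos (norm_pos_iff.2 hη0) 2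
  have hpos₂ : 0 < ‖ζ‖ ^ 2 := pow_pos (norm_pos_iff.2 hζ0) 2
  have hne₁ : ((‖η‖ ^ 2 : ℝ) : ℂ) ≠ 0 := by exact_mod_cast hpos₁.ne'
  have hne₂ : ((‖ζ‖ ^ 2 : ℝ) : ℂ) ≠ 0 := by exact_mod_cast hpos₂.ne'
  -- The cross terms vanish since `K` and `Kᗮ` are invariant; the weights sum to `‖ξ‖² = 1` by
  -- Pythagoras.
  have hseg : ω ∈ openSegment ℝ φ₁ φ₂ := by
    refine ⟨‖η‖ ^ 2, ‖ζ‖ ^ 2, hpos₁, hpos₂, ?_, ?_⟩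
    · have := norm_add_sq_eq_norm_sq_add_norm_sq_of_inner_eq_zero η ζ hηζ
      rw [← hsum, hξ] at this
      linarith
    · refine DFunLike.ext _ _ fun b => ?_
      show (‖η‖ ^ 2) • φ₁ b + (‖ζ‖ ^ 2) • φ₂ b = ω b
      rw [e₁, e₂, hωξ, Complex.real_smul, Complex.real_smul, mul_inv_cancel_left₀ hne₁,
        mul_inv_cancel_left₀ hne₂, hsum, map_add, inner_add_left, inner_add_right, inner_add_right,
        hcross, hcross', add_zero, zero_add]
  have heq : φ₁ = ω := ((mem_extremePoints.1 hω).2 φ₁ hφ₁ φ₂ hφ₂ hseg).1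
  -- Extremality gives `φ₁ = ω`, so `η - ‖η‖² ξ` is orthogonal to a dense set. Thus `ξ` is a
  -- multiple of `η ∈ K`, and cyclicity gives `K = ⊤`.
  have horth : ∀ b, ⟪η - ((‖η‖ ^ 2 : ℝ) : ℂ) • ξ, π b ξ⟫_ℂ = 0 := fun b => by
    have h1 : ⟪η, π b ξ⟫_ℂ = ⟪η, π b η⟫_ℂ := by
      rw [hsum, map_add, inner_add_right, hcross, add_zero]
    have h2 := e₁ b
    rw [heq, hωξ] at h2
    rw [inner_sub_left, inner_smul_left, h1, Complex.conj_ofReal, h2, mul_inv_cancel_left₀ hne₁,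
      sub_self]
  have hη' : η = ((‖η‖ ^ 2 : ℝ) : ℂ) • ξ := by
    rw [← sub_eq_zero]
    have h := hcyc.equalizer (g := fun x => ⟪η - ((‖η‖ ^ 2 : ℝ) : ℂ) • ξ, x⟫_ℂ) (h := fun _ => 0)
      (by fun_prop) continuous_const (funext horth)
    exact inner_self_eq_zero.1 (congrFun h _)
  refine htop K hK hinv ?_
  have : ξ = ((‖η‖ ^ 2 : ℝ) : ℂ)⁻¹ • η := by
    rw [eq_inv_smul_iff₀ hne₁]
    exact hη'.symm
  rw [this]
  exact K.smul_mem _ hη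

end States

/-! ### GNS representation of an extreme extension -/

section Extension

variable {B : Type u} [CStarAlgebra B]

/-- A contractive character of a central star subalgebra is implemented by an irreducible
representation. -/
theorem exists_irreducibleRep_extending (E : StarSubalgebra ℂ B)
    (hE : ∀ z ∈ E, z ∈ Set.center B) (χ : E →ₐ[ℂ] ℂ) (hχ : ∀ z, ‖χ z‖ ≤ ‖z‖) :
    ∃ (H : Type u) (_ : NormedAddCommGroup H) (_ : InnerProductSpace ℂ H) (_ : CompleteSpace H)
      (π : B →⋆ₐ[ℂ] (H →L[ℂ] H)), IsIrreducibleRep π ∧ ∀ z : E, π z = χ z • (1 : H →L[ℂ] H) := by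
  let _ := CStarAlgebra.spectralOrder B
  have := CStarAlgebra.spectralOrderedRing B
  have : LocallyConvexSpace ℝ (WeakDual ℂ B) :=
    WeakBilin.locallyConvexSpace (B := topDualPairing ℂ B)
  obtain ⟨ω, hω⟩ := (isCompact_contractiveExtensions (E := E) (χ := χ)).extremePoints_nonempty
    (contractiveExtensions_nonempty hχ)
  have hωE := (mem_extremePoints.1 hω).1.2
  have hω1 : ω 1 = 1 := by simpa using hωE 1
  let f : B →ₚ[ℂ] ℂ := PositiveLinearMap.mk₀ (WeakDual.toStrongDual ω).toLinearMap fun x hx =>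
    nonneg_of_contractive_of_map_one _ (mem_extremePoints.1 hω).1.1 hω1 hx
  have hf : ∀ b, f b = ω b := fun b => rfl
  let π := f.gnsStarAlgHom
  let ι : B → f.GNS := fun b => (f.toPreGNS b : f.GNS)
  have hπ : ∀ b c, π b (ι c) = ι (b * c) := fun b c =>
    f.gnsNonUnitalStarAlgHom_apply_coe
  have hι : ∀ b c, ⟪ι b, ι c⟫_ℂ = ω (star b * c) := fun b c => by
    simp only [ι, UniformSpace.Completion.inner_coe]
    rfl
  have hdense : DenseRange ι :=
    UniformSpace.Completion.denseRange_coe.comp f.toPreGNS.surjective.denseRange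
      (UniformSpace.Completion.continuous_coe _)
  have hext : ∀ S T : f.GNS →L[ℂ] f.GNS, (∀ b, S (ι b) = T (ι b)) → S = T := fun S T h =>
    ContinuousLinearMap.coeFn_injective (hdense.equalizer S.continuous T.continuous (funext h))
  have hz : ∀ z : E, π z = χ z • (1 : f.GNS →L[ℂ] f.GNS) := by
    intro z
    -- `ω` restricts to the multiplicative `χ`, so it kills `star w * w` for `w = z - χ z • 1`.
    -- Centrality then carries this from the cyclic vector to all `ι b`.
    have hker : ι (z - χ z • 1) = 0 := by
      have hmem : χ (z - χ z • 1) = 0 := by simp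
      have h := hωE (star (z - χ z • 1) * (z - χ z • 1))
      rw [map_mul, hmem, mul_zero] at h
      rw [← inner_self_eq_zero (𝕜 := ℂ), hι]
      exact h
    refine hext _ _ fun b => ?_
    have hc : (z - χ z • 1 : B) * b = b * (z - χ z • 1) := by
      have : (z : B) * b = b * z := (Set.mem_center_iff.1 (hE z z.2)).comm b
      rw [sub_mul, mul_sub, this, smul_one_mul, mul_smul_one]
    have h0 : ι ((z - χ z • 1 : B) * b) = 0 := by
      rw [hc, ← hπ, hker, map_zero]
    rw [← hπ, map_sub, map_smul, map_one] at h0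
    simpa [sub_eq_zero] using h0
  refine ⟨f.GNS, inferInstance, inferInstance, inferInstance, π, ?_, hz⟩
  refine isIrreducibleRep_of_mem_extremePoints π (ι 1) ?_ ?_ hz ω (fun b => ?_) hω
  · have h := hι 1 1
    rw [star_one, mul_one, hω1, inner_self_eq_norm_sq_to_K] at h
    have h' : ‖ι 1‖ ^ 2 = 1 := Complex.ofReal_injective (by simpa using h)
    exact (pow_eq_one_iff_of_nonneg (norm_nonneg _) two_ne_zero).1 h'
  · simpa only [hπ, mul_one] using hdense
  · rw [hπ, hι, star_one, one_mul, mul_one]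

end Extension

/-! ### Centres and primitive ideals -/

section Center

variable {A : Type u} [CStarAlgebra A]

variable (A) in
/-- The centre of a C⋆-algebra as a star subalgebra. -/
def starCenter : StarSubalgebra ℂ A where
  __ := Subalgebra.center ℂ A
  star_mem' := Set.star_mem_center

instance isClosed_starCenter : IsClosed (starCenter A : Set A) := by
  have : (starCenter A : Set A) = ⋂ b : A, {z | b * z = z * b} := by
    ext z
    simp only [Set.mem_iInter, Set.mem_ofPred_eq]
    exact Subalgebra.mem_center_iff (R := ℂ)
  rw [this]
  exact isClosed_iInter fun b => isClosed_eq (by fun_prop) (by fun_prop)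

noncomputable instance starCenterCommCStarAlgebra : CommCStarAlgebra (starCenter A) where
  __ := StarSubalgebra.cstarAlgebra (starCenter A)
  mul_comm x y := Subtype.ext ((Set.mem_center_iff.1 x.2).comm y)

theorem mem_map_quotient_mk_iff {I P : Ideal A} [I.IsTwoSided] (hP : I ≤ P) {x : A} :
    Ideal.Quotient.mk I x ∈ P.map (Ideal.Quotient.mk I) ↔ x ∈ P := by
  rw [← Ideal.mem_comap, Ideal.comap_map_mk hP]

variable (I : Ideal A) [I.IsTwoSided] [hI : IsClosed (I : Set A)]

/-- The map from the centre of `A` to the centre of `A ⧸ I`. -/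
def starCenterQuotientMap : starCenter A →⋆ₐ[ℂ] starCenter (A ⧸ I) where
  toFun z := ⟨Ideal.Quotient.mk I z, by
    refine (Subalgebra.mem_center_iff (R := ℂ)).2 fun y => ?_
    obtain ⟨y, rfl⟩ := Ideal.Quotient.mk_surjective y
    rw [← map_mul, ← map_mul, (Subalgebra.mem_center_iff (R := ℂ)).1 z.2 y]⟩
  map_one' := rfl
  map_mul' _ _ := rfl
  map_zero' := rfl
  map_add' _ _ := rfl
  commutes' _ := rfl
  map_star' _ := rfl

variable {I}

theorem daunsHofmann_quot_eq_iff {a : A}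
    (ha : Ideal.Quotient.mk I a ∈ Subalgebra.center ℂ (A ⧸ I)) (P : PrimitiveIdealsAbove I)
    (c : ℂ) : daunsHofmann ⟨Ideal.Quotient.mk I a, ha⟩ P.quot = c ↔ a - c • (1 : A) ∈ P.1.1 := by
  rw [daunsHofmann_eq_iff, ← mem_map_quotient_mk_iff P.2]
  rfl

/-- Every character of the centre of `A ⧸ I` is evaluation of Dauns-Hofmann functions at a primitive
ideal of `A` containing `I`. -/
theorem exists_primitiveIdealAbove_of_character
    (χ : WeakDual.characterSpace ℂ (starCenter (A ⧸ I))) :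
    ∃ P : PrimitiveIdealsAbove I, ∀ (x : A) (hx : Ideal.Quotient.mk I x ∈ starCenter (A ⧸ I)),
      x - χ ⟨Ideal.Quotient.mk I x, hx⟩ • (1 : A) ∈ P.1.1 := by
  have : Nontrivial (starCenter (A ⧸ I)) :=
    ⟨1, 0, fun h => by simpa [h] using (map_one χ).symm⟩
  obtain ⟨H, _, _, _, π, hπ, hz⟩ := exists_irreducibleRep_extending (starCenter (A ⧸ I))
    (fun z hz => hz) (WeakDual.CharacterSpace.toAlgHom χ)
    fun z => AlgHom.norm_apply_le_self _ z
  let q : A →⋆ₐ[ℂ] (A ⧸ I) :=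
    { Ideal.Quotient.mkₐ ℂ I with map_star' := fun _ => rfl }
  have hq : ∀ x, π.comp q x = π (Ideal.Quotient.mk I x) := fun _ => rfl
  -- `q` is surjective, so `π.comp q` and `π` have the same invariant subspaces.
  have hirr : IsIrreducibleRep (π.comp q) := ⟨hπ.1, fun K hK hinv => hπ.2 K hK fun b ξ hξ => by
    obtain ⟨b, rfl⟩ := Ideal.Quotient.mk_surjective b
    exact hinv b ξ hξ⟩
  refine ⟨⟨⟨RingHom.ker (π.comp q), H, _, _, _, _, hirr, rfl⟩, fun x hx => ?_⟩, fun x hx => ?_⟩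
  · rw [RingHom.mem_ker, hq, Ideal.Quotient.eq_zero_iff_mem.2 hx, map_zero]
  · show x - _ ∈ RingHom.ker (π.comp q)
    rw [RingHom.mem_ker, map_sub, map_smul, map_one, hq]
    exact sub_eq_zero.2 (hz ⟨_, hx⟩)

end Center

theorem mainTheorem3 {A : Type u} [CStarAlgebra A] (I : Ideal A) [I.IsTwoSided]
    [IsClosed (I : Set A)] (a : A)
    (ha : Ideal.Quotient.mk I a ∈ Subalgebra.center ℂ (A ⧸ I)) :
    a ∈ Set.center A + (I : Set A) ↔
      ∀ P₁ P₂ : PrimitiveIdealsAbove I,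
        (P₁.1.1 : Set A) ∩ Set.center A = (P₂.1.1 : Set A) ∩ Set.center A →
        daunsHofmann ⟨Ideal.Quotient.mk I a, ha⟩ P₁.quot =
          daunsHofmann ⟨Ideal.Quotient.mk I a, ha⟩ P₂.quot := by
  have hscalar : ∀ {z : A} (c : ℂ), z ∈ Set.center A → z - c • (1 : A) ∈ Set.center A :=
    fun {z} c hz => (starCenter A).sub_mem hz ((starCenter A).smul_mem (starCenter A).one_mem c)
  constructor
  · rintro ⟨z, hz, i, hi, rfl⟩ P₁ P₂ h
    obtain ⟨c, hc, -⟩ := existsUnique_scalar (⟨z, hz⟩ : Subalgebra.center ℂ A) P₁.1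
    have hc₂ : z - c • (1 : A) ∈ P₂.1.1 :=
      (h.subset ⟨hc, hscalar c hz⟩ : z - c • (1 : A) ∈ (P₂.1.1 : Set A) ∩ Set.center A).1
    have hadd : z + i - c • (1 : A) = z - c • (1 : A) + i := by abel
    rw [(daunsHofmann_quot_eq_iff ha P₁ c).2 (hadd ▸ P₁.1.1.add_mem hc (P₁.2 hi)),
      (daunsHofmann_quot_eq_iff ha P₂ c).2 (hadd ▸ P₂.1.1.add_mem hc₂ (P₂.2 hi))]
  · intro h
    let φ := starCenterQuotientMap I
    have hmem : (⟨Ideal.Quotient.mk I a, ha⟩ : starCenter (A ⧸ I)) ∈ φ.range := by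
      refine StarSubalgebra.mem_of_forall_character φ.range ?_ _ fun χ₁ χ₂ hχ => ?_
      · exact φ.isClosed_range_cstar
      obtain ⟨P₁, hP₁⟩ := exists_primitiveIdealAbove_of_character χ₁
      obtain ⟨P₂, hP₂⟩ := exists_primitiveIdealAbove_of_character χ₂
      rw [← (daunsHofmann_quot_eq_iff ha P₁ _).2 (hP₁ a ha),
        ← (daunsHofmann_quot_eq_iff ha P₂ _).2 (hP₂ a ha)]
      refine h P₁ P₂ ?_
      ext z
      refine and_congr_left fun hz => ?_
      have e : χ₁ (φ ⟨z, hz⟩) = χ₂ (φ ⟨z, hz⟩) := hχ _ ⟨_, rfl⟩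
      have h₁ := hP₁ z (φ ⟨z, hz⟩).2
      have h₂ := hP₂ z (φ ⟨z, hz⟩).2
      -- A central `z` lies in `P` exactly when its scalar there is `0`; at `P₁` and `P₂` these
      -- scalars are the values of `χ₁` and `χ₂` at `φ z`, equal by `e`.
      have hiff : ∀ (P : PrimitiveIdeals A) (c : ℂ), z - c • (1 : A) ∈ P.1 → (z ∈ P.1 ↔ c = 0) :=
        fun P c hc => ⟨fun hzP => (existsUnique_scalar (⟨z, hz⟩ : Subalgebra.center ℂ A) P).unique
          hc (by simpa using hzP), fun h0 => by simpa [h0] using hc⟩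
      exact (hiff P₁.1 _ h₁).trans ((Eq.congr_left e).trans (hiff P₂.1 _ h₂).symm)
    obtain ⟨z, hz⟩ := hmem
    refine ⟨z, z.2, a - z, ?_, add_sub_cancel _ _⟩
    exact Ideal.Quotient.eq.1 (congrArg Subtype.val hz).symm
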